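/- Conventions. A Boolean algebra $B$ is regarded as the commutative semiring $(B,\vee,\wedge,0,1)$; in particular $\mathbf{B}=\{0,1\}$ is the two-element Boolean algebra, with $1+1=1$. A semiring $S$ is a (right) CP-semiring if every cyclic right $S$-semimodule, i.e. every homomorphic image of the regular right semimodule $S_S$, is projective, i.e. a retract of a free right $S$-semimodule. Endomorphism semirings have pointwise addition and composition $(fg)(x)=f(g(x))$ as multiplication. A $\mathbf{B}$-semimodule $X$ (equivalently, a commutative monoid with $x+x=x$) carries the natural order $x\le y \iff x+y=y$; it is called a distributive lattice if it is one for this order. Theorem. Let $M$ be a nonzero right semimodule over an arbitrary Boolean algebra $B$, let $J=\mathrm{Ann}_B(M)=\{b\in B : mb=0 \text{ for all } m\in M\}$, and let $B/J$ be the quotient Boolean algebra, in which $x$ and $y$ are identified iff $x+i=y+j$ for some $i,j\in J$. Then $M$ is a $B/J$-semimodule; for $a\in B/J$ put $Ma=\{ma : m\in M\}$, regarded as a $\mathbf{B}$-semimodule. For each one of the following three conditions (C) on a finite distributive lattice $X$, the semiring $\mathrm{End}(M_B)$ is a right CP-semiring if and only if $B/J$ is finite and, for every atom $a$ of $B/J$,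 $X=Ma$ is a finite distributive lattice satisfying (C): (1) the semiring $\mathrm{End}(X_{\mathbf{B}})$ of $\mathbf{B}$-semimodule endomorphisms of $X$ is a right CP-semiring; (2) for every congruence $\theta$ of the $\mathbf{B}$-semimodule $X$, the quotient $X/\theta$ is a distributive lattice; (3) if $T(X)$ denotes the set of all elements of $X$ that are comparable with every element of $X$, and if $t\le t'$ are elements of $T(X)$ with $[t,t']\cap T(X)=\{t,t'\}$, then either $[t,t']=\{t,t'\}$ or $[t,t']$ is isomorphic to $\mathbf{B}^2$. -/

import Mathlib

universe u v

/-! ### Boolean algebras as semirings -/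

/-- A Boolean algebra `B`, regarded as the commutative semiring `(B, ⊔, ⊓, ⊥, ⊤)`. It is a copy of
`B`, so that its addition cannot be confused with another addition on the same type (such as
the symmetric difference on `Bool`). -/
def BoolSemiring (B : Type u) : Type u := B

namespace BoolSemiring

variable {B : Type u}

instance [BooleanAlgebra B] : BooleanAlgebra (BoolSemiring B) :=
  inferInstanceAs (BooleanAlgebra B)

instance [BooleanAlgebra B] : Add (BoolSemiring B) := ⟨fun x y => x ⊔ y⟩

instance [BooleanAlgebra B] : Zero (BoolSemiring B) := ⟨⊥⟩

instance [BooleanAlgebra B] : Mul (BoolSemiring B) := ⟨fun x y => x ⊓ y⟩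

instance [BooleanAlgebra B] : One (BoolSemiring B) := ⟨⊤⟩

instance [BooleanAlgebra B] : CommSemiring (BoolSemiring B) where
  add_assoc x y z := sup_assoc x y z
  zero_add x := bot_sup_eq x
  add_zero x := sup_bot_eq x
  add_comm x y := sup_comm x y
  mul_assoc x y z := inf_assoc x y z
  mul_comm x y := inf_comm x y
  one_mul x := top_inf_eq x
  mul_one x := inf_top_eq x
  zero_mul x := bot_inf_eq x
  mul_zero x := inf_bot_eq x
  left_distrib x y z := inf_sup_left x y z
  right_distrib x y z := inf_sup_right x y z
  nsmul := nsmulRec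

theorem add_eq_sup [BooleanAlgebra B] (x y : BoolSemiring B) : x + y = x ⊔ y := rfl

theorem mul_eq_inf [BooleanAlgebra B] (x y : BoolSemiring B) : x * y = x ⊓ y := rfl

theorem zero_eq_bot [BooleanAlgebra B] : (0 : BoolSemiring B) = ⊥ := rfl

theorem one_eq_top [BooleanAlgebra B] : (1 : BoolSemiring B) = ⊤ := rfl

end BoolSemiring

/-- The Boolean semifield `𝐁 = {0, 1}` with `1 + 1 = 1`. -/
abbrev BoolSemifield : Type := BoolSemiring Bool

/-! ### CP-semirings -/

/-- `S` is a right CP-semiring: every cyclic right `S`-semimodule is projective.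
Right `S`-semimodules are left semimodules over the opposite semiring `Sᵐᵒᵖ`; such a semimodule
is cyclic if it is a homomorphic image of the regular right semimodule `S`. Every cyclic right
`S`-semimodule is isomorphic to a quotient of `S`, so the universe of `S` suffices. -/
def IsRightCPSemiring (S : Type u) [Semiring S] : Prop :=
  ∀ (N : Type u) [AddCommMonoid N] [Module Sᵐᵒᵖ N],
    (∃ f : S →ₗ[Sᵐᵒᵖ] N, Function.Surjective f) → Module.Projective Sᵐᵒᵖ N

/-! ### The quotient of a commutative semiring by an ideal -/

/-- The Bourne congruence of an ideal `I`: `x ≡ y` iff `x + i = y + j` for some `i, j ∈ I`. -/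
def bourneCon {R : Type u} [CommSemiring R] (I : Ideal R) : RingCon R where
  r x y := ∃ i ∈ I, ∃ j ∈ I, x + i = y + j
  iseqv :=
    { refl := fun _ => ⟨0, I.zero_mem, 0, I.zero_mem, rfl⟩
      symm := fun ⟨i, hi, j, hj, h⟩ => ⟨j, hj, i, hi, h.symm⟩
      trans := by
        rintro x y z ⟨i, hi, j, hj, h⟩ ⟨k, hk, l, hl, h'⟩
        refine ⟨i + k, I.add_mem hi hk, l + j, I.add_mem hl hj, ?_⟩
        rw [← add_assoc, h, ← add_assoc, ← h']
        ring }
  add' := by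
    rintro w x y z ⟨i, hi, j, hj, h⟩ ⟨k, hk, l, hl, h'⟩
    refine ⟨i + k, I.add_mem hi hk, j + l, I.add_mem hj hl, ?_⟩
    rw [add_add_add_comm, h, h', add_add_add_comm]
  mul' := by
    rintro w x y z ⟨i, hi, j, hj, h⟩ ⟨k, hk, l, hl, h'⟩
    refine ⟨w * k + i * y + i * k, ?_, x * l + j * z + j * l, ?_, ?_⟩
    · exact I.add_mem (I.add_mem (I.mul_mem_left _ hk) (I.mul_mem_right _ hi))
        (I.mul_mem_right _ hi)
    · exact I.add_mem (I.add_mem (I.mul_mem_left _ hl) (I.mul_mem_right _ hj))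
        (I.mul_mem_right _ hj)
    · calc w * y + (w * k + i * y + i * k) = (w + i) * (y + k) := by ring
        _ = (x + j) * (z + l) := by rw [h, h']
        _ = x * z + (x * l + j * z + j * l) := by ring

/-- The quotient semiring `R/I` by the Bourne congruence. -/
abbrev BourneQuotient {R : Type u} [CommSemiring R] (I : Ideal R) : Type u :=
  (bourneCon I).Quotient

namespace BourneQuotient

variable {B : Type u} [BooleanAlgebra B]

/-- The complement on the quotient of a Boolean algebra by an ideal. -/
def compl {I : Ideal (BoolSemiring B)} : BourneQuotient I → BourneQuotient I :=
  Quotient.map' (fun x : BoolSemiring B => xᶜ) (by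
    rintro x y ⟨i, hi, j, hj, h⟩
    refine ⟨i + j, I.add_mem hi hj, i + j, I.add_mem hi hj, ?_⟩
    simp only [BoolSemiring.add_eq_sup] at h ⊢
    have key : ∀ p q a b : BoolSemiring B, p ⊔ a = q ⊔ b → pᶜ ≤ qᶜ ⊔ (a ⊔ b) := by
      intro p q a b hh
      have h1 : q ≤ p ⊔ a := hh ▸ le_sup_left
      have h2 : pᶜ ⊓ q ≤ a ⊔ b := by
        calc pᶜ ⊓ q ≤ pᶜ ⊓ (p ⊔ a) := inf_le_inf_left _ h1
          _ ≤ a := by rw [inf_sup_left, compl_inf_eq_bot, bot_sup_eq]; exact inf_le_right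
          _ ≤ a ⊔ b := le_sup_left
      calc pᶜ = pᶜ ⊓ qᶜ ⊔ pᶜ ⊓ q := by rw [← inf_sup_left, compl_sup_eq_top, inf_top_eq]
        _ ≤ qᶜ ⊔ (a ⊔ b) := sup_le_sup inf_le_right h2
    apply le_antisymm
    · exact sup_le (key x y i j h) le_sup_right
    · refine sup_le ?_ le_sup_right
      rw [sup_comm i j]
      exact key y x j i h.symm)

/-- The quotient of a Boolean algebra by an ideal is a Boolean algebra, whose join and meet are
the addition and the multiplication of the quotient semiring, and whose order is therefore
`x ≤ y ↔ x + y = y`. -/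
instance (I : Ideal (BoolSemiring B)) : BooleanAlgebra (BourneQuotient I) :=
  let mk : BoolSemiring B → BourneQuotient I := fun x => (x : BourneQuotient I)
  letI : Max (BourneQuotient I) := ⟨fun x y => x + y⟩
  letI : Min (BourneQuotient I) := ⟨fun x y => x * y⟩
  letI L : Lattice (BourneQuotient I) := Lattice.mk'
    (fun a b => add_comm a b) (fun a b c => add_assoc a b c)
    (fun a b => mul_comm a b) (fun a b c => mul_assoc a b c)
    (by rintro ⟨a⟩ ⟨b⟩; exact congrArg mk (sup_inf_self (a := a) (b := b)))
    (by rintro ⟨a⟩ ⟨b⟩; exact congrArg mk (inf_sup_self (a := a) (b := b)))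
  letI D : DistribLattice (BourneQuotient I) := DistribLattice.ofInfSupLe
    (fun a b c => le_of_eq (mul_add a b c))
  { D with
    compl := compl
    top := 1
    bot := 0
    le_top := by rintro ⟨a⟩; exact congrArg mk (sup_top_eq a)
    bot_le := fun a => zero_add a
    inf_compl_le_bot := by
      rintro ⟨a⟩
      exact le_of_eq (congrArg mk (inf_compl_eq_bot (a := a)))
    top_le_sup_compl := by
      rintro ⟨a⟩
      exact le_of_eq (congrArg mk (sup_compl_eq_top (x := a))).symm }

theorem le_iff {I : Ideal (BoolSemiring B)} (x y : BourneQuotient I) : x ≤ y ↔ x + y = y := Iff.rfl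

theorem sup_eq_add {I : Ideal (BoolSemiring B)} (x y : BourneQuotient I) : x ⊔ y = x + y := rfl

theorem inf_eq_mul {I : Ideal (BoolSemiring B)} (x y : BourneQuotient I) : x ⊓ y = x * y := rfl

end BourneQuotient

/-- Every semimodule over a Boolean algebra is additively idempotent. -/
theorem BoolSemiring.add_self_eq (B : Type u) [BooleanAlgebra B] {M : Type v} [AddCommMonoid M]
    [Module (BoolSemiring B) M] (m : M) : m + m = m := by
  have h : (1 : BoolSemiring B) + 1 = 1 := sup_idem (⊤ : BoolSemiring B)
  calc m + m = ((1 : BoolSemiring B) + 1) • m := by rw [add_smul, one_smul]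
    _ = m := by rw [h, one_smul]

/-! ### The reduced Boolean algebra of a semimodule -/

section Semimodule

variable (B : Type u) [BooleanAlgebra B] (M : Type v) [AddCommMonoid M] [Module (BoolSemiring B) M]

/-- The Boolean algebra `B/J`, where `J = {b : B | m b = 0 for all m ∈ M}` is the annihilator
of the `B`-semimodule `M`. (`B` is commutative, so left and right semimodules are the same and
`m b` is written `b • m`.) -/
abbrev AnnQuotient : Type u := BourneQuotient (Module.annihilator (BoolSemiring B) M)

variable {B M}

/-- The action of `B/J` on `M` induced by that of `B`. -/
instance : SMul (AnnQuotient B M) M where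
  smul a m := Quotient.liftOn' a (fun b : BoolSemiring B => b • m) (by
    rintro x y ⟨i, hi, j, hj, h⟩
    have h1 := congrArg (fun b : BoolSemiring B => b • m) h
    simpa [add_smul, Module.mem_annihilator.mp hi m, Module.mem_annihilator.mp hj m] using h1)

theorem AnnQuotient.coe_smul (b : BoolSemiring B) (m : M) : (b : AnnQuotient B M) • m = b • m := rfl

instance : Module (AnnQuotient B M) M where
  one_smul m := one_smul (BoolSemiring B) m
  mul_smul := by rintro ⟨a⟩ ⟨b⟩ m; exact mul_smul a b m
  smul_zero := by rintro ⟨a⟩; exact smul_zero a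
  smul_add := by rintro ⟨a⟩ m n; exact smul_add a m n
  add_smul := by rintro ⟨a⟩ ⟨b⟩ m; exact add_smul a b m
  zero_smul m := zero_smul (BoolSemiring B) m

/-- The subsemimodule `M a = {m a | m ∈ M}` of `M`, for `a ∈ B/J`. -/
def componentAt (a : AnnQuotient B M) : AddSubmonoid M :=
  AddMonoidHom.mrange (DistribSMul.toAddMonoidHom M a)

theorem mem_componentAt (a : AnnQuotient B M) (x : M) : x ∈ componentAt a ↔ ∃ m : M, a • m = x :=
  Iff.rfl

end Semimodule

/-! ### Semimodules over the Boolean semifield: semilattices with zero -/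

/-- The (only) structure of a `𝐁`-semimodule on a commutative monoid with `x + x = x`. -/
@[reducible]
def moduleOfAddIdem (X : Type v) [AddCommMonoid X] (h : ∀ x : X, x + x = x) :
    Module BoolSemifield X where
  smul b x := Bool.rec 0 x b
  one_smul _ := rfl
  mul_smul := by rintro (_ | _) (_ | _) x <;> rfl
  smul_zero := by rintro (_ | _) <;> rfl
  smul_add := by
    rintro (_ | _) x y
    · exact (add_zero (0 : X)).symm
    · rfl
  add_smul := by
    rintro (_ | _) (_ | _) x
    · exact (add_zero (0 : X)).symm
    · exact (zero_add x).symm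
    · exact (add_zero x).symm
    · exact (h x).symm
  zero_smul _ := rfl

instance {B : Type u} [BooleanAlgebra B] {M : Type v} [AddCommMonoid M] [Module (BoolSemiring B) M]
    (a : AnnQuotient B M) : Module BoolSemifield (componentAt a) :=
  moduleOfAddIdem _ fun x => Subtype.ext (BoolSemiring.add_self_eq B (x : M))

section Lattice

variable (X : Type v) [AddCommMonoid X] [Module BoolSemifield X]

/-- The natural order of a `𝐁`-semimodule: `x ≤ y` iff `x + y = y`. -/
@[reducible]
def naturalOrder : PartialOrder X where
  le x y := x + y = y
  le_refl x := BoolSemiring.add_self_eq Bool x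
  le_trans x y z hxy hyz := by
    change x + y = y at hxy
    change y + z = z at hyz
    rw [← hyz, ← add_assoc, hxy]
  le_antisymm x y hxy hyx := by
    change x + y = y at hxy
    change y + x = x at hyx
    rw [← hxy, add_comm, hyx]

/-- The natural order of the `𝐁`-semimodule `X` makes it a distributive lattice. -/
def IsDistributiveLattice : Prop :=
  ∃ L : DistribLattice X, L.toPartialOrder = naturalOrder X

/-- Every quotient of the `𝐁`-semimodule `X` by a congruence is a distributive lattice. -/
def AllQuotientsDistributive : Prop :=
  ∀ θ : ModuleCon BoolSemifield X, IsDistributiveLattice θ.Quotient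

/-- The set `T(X)` of the elements of `X` that are comparable with all elements of `X`. -/
def comparableElements : Set X :=
  letI := naturalOrder X
  {t | ∀ x : X, x ≤ t ∨ t ≤ x}

/-- Whenever `t ≤ t'` are elements of `T(X)` such that the interval `[t, t']` meets `T(X)` in `t`
and `t'` only, the interval `[t, t']` is either `{t, t'}` or isomorphic to `𝐁²`. -/
def HasSmallSteps : Prop :=
  letI := naturalOrder X
  ∀ t ∈ comparableElements X, ∀ t' ∈ comparableElements X, t ≤ t' →
    Set.Icc t t' ∩ comparableElements X = {t, t'} →
      Set.Icc t t' = {t, t'} ∨ Nonempty (Set.Icc t t' ≃o BoolSemifield × BoolSemifield)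

end Lattice

/-! A cyclic module `S/c` is projective exactly when its projection from `S` splits. A splitting
amounts to an element `e`, congruent to `1`, whose left multiplication identifies all `c`-congruent
elements (`isRightCPSemiring_iff`). Necessity of the conditions comes from evaluating this on
well-chosen right congruences; sufficiency comes from building `e`.

The algebra `B/J` reduces to its atoms. A congruence attached to an ascending chain in `B/J` forces
the chain to stop, so `B/J` is finite and `1` is the sum of its atoms. Endomorphisms respect the
components `M a`. Restriction to a component is a surjective semiring map, so the CP property
descends, and elements `e` found on the components add up to one for `M`
(`isRightCPSemiring_of_components`).

For a component `X` over `𝐁`, the three conditions meet in a fourth one, `HasSmallJoins`. The CP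
property implies it, and also implies that `X` is finite. Under it each element is incomparable to
at most one other, so a finite `X` is a stack of points and squares `𝐁²`; this is condition (3), and
conversely (3) gives small joins. Small joins pass to quotients and give distributivity in the
finite case, hence (2). Finally (2) gives (1): a right congruence on `End X` is determined by the
congruence it induces on `X` through constant maps, and the quotient of `X`, a finite distributive
lattice, is projective, so its projection has a section, from which `e` is made. -/

/-! ### Right congruences and right CP-semirings -/

/-- The quotient map of a module by a congruence. -/
def ModuleCon.mkLinear {R : Type u} {N : Type v} [Semiring R] [AddCommMonoid N] [Module R N]
    (c : ModuleCon R N) : N →ₗ[R] c.Quotient where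
  toFun := Quotient.mk c.toSetoid
  map_add' _ _ := rfl
  map_smul' _ _ := rfl

theorem ModuleCon.mkLinear_surjective {R : Type u} {N : Type v} [Semiring R] [AddCommMonoid N]
    [Module R N] (c : ModuleCon R N) : Function.Surjective c.mkLinear :=
  Quotient.mk_surjective

theorem ModuleCon.mkLinear_eq_iff {R : Type u} {N : Type v} [Semiring R] [AddCommMonoid N]
    [Module R N] (c : ModuleCon R N) {x y : N} : c.mkLinear x = c.mkLinear y ↔ c.r x y :=
  Quotient.eq

/-- A right congruence on a semiring, from the properties of its relation. -/
def rightCon {S : Type u} [Semiring S] (r : S → S → Prop) (hr : Equivalence r)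
    (hadd : ∀ {f g f' g' : S}, r f g → r f' g' → r (f + f') (g + g'))
    (hmul : ∀ (s : S) {f g : S}, r f g → r (f * s) (g * s)) : ModuleCon Sᵐᵒᵖ S where
  r := r
  iseqv := hr
  add' := hadd
  smul s _ _ h := hmul s.unop h

theorem projective_self_op (S : Type u) [Semiring S] : Module.Projective Sᵐᵒᵖ S :=
  Module.Projective.of_equiv (R := Sᵐᵒᵖ) (S := Sᵐᵒᵖ) (M := Sᵐᵒᵖ) (N := S) (σ := RingHom.id _)
    { toFun := MulOpposite.unop
      invFun := MulOpposite.op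
      map_add' := fun _ _ => rfl
      map_smul' := fun _ _ => rfl }

/-- `S` is a right CP-semiring iff every right congruence on `S` is the kernel of the left
multiplication by an element congruent to `1`. -/
theorem isRightCPSemiring_iff (S : Type u) [Semiring S] :
    IsRightCPSemiring S ↔
      ∀ c : ModuleCon Sᵐᵒᵖ S, ∃ e : S, c.r e 1 ∧ ∀ f g, c.r f g → e * f = e * g := by
  constructor
  · intro H c
    have hP : Module.Projective Sᵐᵒᵖ c.Quotient := H c.Quotient ⟨c.mkLinear, c.mkLinear_surjective⟩
    obtain ⟨σ, hσ⟩ := Module.projective_lifting_property c.mkLinear LinearMap.id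
      c.mkLinear_surjective
    have key : ∀ f : S, σ (c.mkLinear f) = σ (c.mkLinear 1) * f := by
      intro f
      have h : c.mkLinear f = MulOpposite.op f • c.mkLinear 1 := by
        rw [← map_smul]
        simp
      rw [h, map_smul]
      rfl
    refine ⟨σ (c.mkLinear 1), ?_, fun f g h => ?_⟩
    · rw [← c.mkLinear_eq_iff]
      exact LinearMap.congr_fun hσ _
    · rw [← key, ← key, c.mkLinear_eq_iff.2 h]
  · rintro H N _ _ ⟨π, hπ⟩
    let c : ModuleCon Sᵐᵒᵖ S := rightCon (fun f g => π f = π g)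
      ⟨fun _ => rfl, fun h => h.symm, fun h h' => h.trans h'⟩
      (fun h h' => by rw [map_add, map_add, h, h'])
      (fun s f g h => by
        have h1 : ∀ t : S, π (t * s) = MulOpposite.op s • π t := fun t => by
          rw [← map_smul]; rfl
        rw [h1, h1, h])
    obtain ⟨e, he, hk⟩ := H c
    have he' : π e = π 1 := he
    -- `g` is only a set-theoretic section. Multiplication by `e` makes it linear, since `e` does
    -- not distinguish elements with the same image under `π`.
    let g : N → S := Function.surjInv hπ
    have hg : ∀ n, π (g n) = n := Function.surjInv_eq hπ
    let i : N →ₗ[Sᵐᵒᵖ] S :=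
      { toFun := fun n => e * g n
        map_add' := fun m n => by
          rw [← mul_add]
          apply hk
          change π _ = π _
          rw [map_add, hg, hg, hg]
        map_smul' := fun s n => by
          have : e * g (s • n) = e * (s • g n) := by
            apply hk
            change π _ = π _
            rw [map_smul, hg, hg]
          rw [this]
          change e * (g n * s.unop) = (e * g n) * s.unop
          rw [mul_assoc] }
    have := projective_self_op S
    refine Module.Projective.of_split i π (LinearMap.ext fun n => ?_)
    change π (e * g n) = n
    have h1 : ∀ t : S, π (t * g n) = MulOpposite.op (g n) • π t := fun t => by
      rw [← map_smul]; rfl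
    rw [h1, he', ← h1, one_mul, hg]

/-- Surjective homomorphisms preserve right CP-semirings. -/
theorem IsRightCPSemiring.of_surjective {S : Type u} {T : Type v} [Semiring S] [Semiring T]
    (hS : IsRightCPSemiring S) (ρ : S →+* T) (hρ : Function.Surjective ρ) :
    IsRightCPSemiring T := by
  rw [isRightCPSemiring_iff] at hS ⊢
  intro c
  -- Pull `c` back along `ρ`; the image of the resulting `e` serves for `c`.
  obtain ⟨e, he, hk⟩ := hS (rightCon (fun f g => c.r (ρ f) (ρ g))
    ⟨fun _ => c.iseqv.refl _, fun h => c.iseqv.symm h, fun h h' => c.iseqv.trans h h'⟩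
    (fun h h' => by rw [map_add, map_add]; exact c.add' h h')
    (fun s f g h => by rw [map_mul, map_mul]; exact c.smul (MulOpposite.op (ρ s)) h))
  refine ⟨ρ e, by simpa using (show c.r (ρ e) (ρ 1) from he), fun f g h => ?_⟩
  obtain ⟨f, rfl⟩ := hρ f
  obtain ⟨g, rfl⟩ := hρ g
  rw [← map_mul, ← map_mul, hk f g h]

/-! ### Semilattices with small joins -/

section Semilattice

variable {X : Type v} [AddCommMonoid X] [Module BoolSemifield X]

/-- The semilattice with zero underlying a `𝐁`-semimodule. -/
@[reducible]
def joinSemilattice (X : Type v) [AddCommMonoid X] [Module BoolSemifield X] : SemilatticeSup X where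
  __ := naturalOrder X
  sup x y := x + y
  le_sup_left x y := by
    change x + (x + y) = x + y
    rw [← add_assoc, BoolSemiring.add_self_eq Bool x]
  le_sup_right x y := by
    change y + (x + y) = x + y
    rw [add_left_comm, BoolSemiring.add_self_eq Bool y]
  sup_le x y z hx hy := by
    change x + z = z at hx
    change y + z = z at hy
    change x + y + z = z
    rw [add_assoc, hy, hx]

attribute [local instance] joinSemilattice

theorem natural_le_iff {x y : X} : x ≤ y ↔ x + y = y := Iff.rfl

theorem zero_le_natural (x : X) : (0 : X) ≤ x := zero_add x

theorem add_le_natural {x y z : X} : x + y ≤ z ↔ x ≤ z ∧ y ≤ z := sup_le_iff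

theorem le_add_natural_left (x y : X) : x ≤ x + y := le_sup_left (a := x)

theorem le_add_natural_right (x y : X) : y ≤ x + y := le_sup_right (a := x)

theorem natural_le_zero {x : X} : x ≤ 0 ↔ x = 0 :=
  ⟨fun h => le_antisymm h (zero_le_natural x), fun h => h.le⟩

theorem map_natural_mono {Y : Type*} [AddCommMonoid Y] [Module BoolSemifield Y]
    (f : X →ₗ[BoolSemifield] Y) {x y : X} (h : x ≤ y) : f x ≤ f y := by
  rw [natural_le_iff] at h ⊢
  rw [← map_add, h]

/-- Every element strictly below a join `a + b` is below `a` or below `b`. -/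
def HasSmallJoins (X : Type v) [AddCommMonoid X] [Module BoolSemifield X] : Prop :=
  ∀ a b d : X, d ≤ a + b → d ≠ a + b → d ≤ a ∨ d ≤ b

/-- Additive maps between `𝐁`-semimodules are linear. -/
def AddMonoidHom.toBoolLinear {Y : Type*} [AddCommMonoid Y] [Module BoolSemifield Y]
    (f : X →+ Y) : X →ₗ[BoolSemifield] Y where
  __ := f
  map_smul' := by
    rintro (_ | _) x
    · exact (congrArg f (zero_smul BoolSemifield x)).trans
        ((map_zero f).trans (zero_smul BoolSemifield (f x)).symm)
    · exact (congrArg f (one_smul BoolSemifield x)).trans (one_smul BoolSemifield (f x)).symm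

open Classical in
/-- The linear map which sends the elements satisfying `p` to `y` and all others to `0`. -/
noncomputable def stepMap {Y : Type*} [AddCommMonoid Y] [Module BoolSemifield Y] (p : X → Prop)
    (h0 : ¬ p 0) (hp : ∀ s t, p (s + t) ↔ p s ∨ p t) (y : Y) : X →ₗ[BoolSemifield] Y :=
  AddMonoidHom.toBoolLinear
    { toFun := fun t => if p t then y else 0
      map_zero' := if_neg h0
      map_add' := fun s t => by
        by_cases hs : p s <;> by_cases ht : p t <;>
          simp [hp, hs, ht, BoolSemiring.add_self_eq Bool y] }

section StepMap

variable {Y : Type*} [AddCommMonoid Y] [Module BoolSemifield Y] {p : X → Prop} {h0 : ¬ p 0}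
  {hp : ∀ s t, p (s + t) ↔ p s ∨ p t}

theorem stepMap_of_pos {t : X} (ht : p t) (y : Y) : stepMap p h0 hp y t = y := if_pos ht

theorem stepMap_of_neg {t : X} (ht : ¬ p t) (y : Y) : stepMap p h0 hp y t = 0 := if_neg ht

end StepMap

theorem add_ne_zero_natural (s t : X) : s + t ≠ 0 ↔ s ≠ 0 ∨ t ≠ 0 := by
  rw [← not_iff_not]
  push Not
  rw [← natural_le_zero, add_le_natural, natural_le_zero, natural_le_zero]

/-- The endomorphism which sends all nonzero elements to `x`. -/
noncomputable def constMap (x : X) : Module.End BoolSemifield X :=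
  stepMap (fun t => t ≠ 0) (fun h => h rfl) add_ne_zero_natural x

theorem constMap_of_ne {t : X} (ht : t ≠ 0) (x : X) : constMap x t = x :=
  if_pos ht

theorem constMap_zero (x : X) : constMap x (0 : X) = 0 := map_zero _

/-- Given a bad triple `a, b, d`, compare endomorphisms by which triples `z ≤ x + y` they send below
`(a, b, d)`. The constant maps to `d` and to `a + b` send no triple with `x` or `y` nonzero there,
so they are congruent and `e d = e (a + b)`. -/
theorem hasSmallJoins_of_isRightCPSemiring
    (h : IsRightCPSemiring (Module.End BoolSemifield X)) : HasSmallJoins X := by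
  rw [isRightCPSemiring_iff] at h
  intro a b d hd hne
  by_contra! hab
  obtain ⟨e, he, hk⟩ := h (rightCon
    (fun f g => ∀ x y z : X, z ≤ x + y →
      ((f x ≤ a ∧ f y ≤ b ∧ f z ≤ d) ↔ (g x ≤ a ∧ g y ≤ b ∧ g z ≤ d)))
    ⟨fun _ _ _ _ _ => Iff.rfl, fun h x y z hz => (h x y z hz).symm,
      fun h h' x y z hz => (h x y z hz).trans (h' x y z hz)⟩
    (fun {f g f' g'} h h' x y z hz => by
      have h1 := h x y z hz
      have h2 := h' x y z hz
      have key : ∀ (u : X) (p q : Module.End BoolSemifield X) (c : X),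
          (p + q) u ≤ c ↔ p u ≤ c ∧ q u ≤ c := fun u p q c => add_le_natural
      rw [key, key, key, key, key, key]
      constructor
      · rintro ⟨⟨hx, hx'⟩, ⟨hy, hy'⟩, hz, hz'⟩
        have k1 := h1.1 ⟨hx, hy, hz⟩
        have k2 := h2.1 ⟨hx', hy', hz'⟩
        exact ⟨⟨k1.1, k2.1⟩, ⟨k1.2.1, k2.2.1⟩, k1.2.2, k2.2.2⟩
      · rintro ⟨⟨hx, hx'⟩, ⟨hy, hy'⟩, hz, hz'⟩
        have k1 := h1.2 ⟨hx, hy, hz⟩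
        have k2 := h2.2 ⟨hx', hy', hz'⟩
        exact ⟨⟨k1.1, k2.1⟩, ⟨k1.2.1, k2.2.1⟩, k1.2.2, k2.2.2⟩)
    (fun s f g h x y z hz => by
      refine h (s x) (s y) (s z) ?_
      rw [← map_add]
      exact map_natural_mono s hz))
  change ∀ x y z : X, z ≤ x + y → ((e x ≤ a ∧ e y ≤ b ∧ e z ≤ d) ↔ (x ≤ a ∧ y ≤ b ∧ z ≤ d)) at he
  have hd0 : d ≠ 0 := fun h0 => hab.1 (h0 ▸ zero_le_natural a)
  have hfg : e * constMap d = e * constMap (a + b) := by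
    apply hk
    intro x y z hz
    by_cases hx : x = 0
    · by_cases hy : y = 0
      · have hz0 : z = 0 := by
          rw [hx, hy, add_zero, natural_le_zero] at hz
          exact hz
        rw [hx, hy, hz0, constMap_zero, constMap_zero]
      · rw [constMap_of_ne hy, constMap_of_ne hy]
        exact ⟨fun h => absurd h.2.1 hab.2, fun h => absurd (hd.trans h.2.1) hab.2⟩
    · rw [constMap_of_ne hx, constMap_of_ne hx]
      exact ⟨fun h => absurd h.1 hab.1, fun h => absurd (hd.trans h.1) hab.1⟩
  have hed : e d = e (a + b) := by
    have := LinearMap.congr_fun hfg d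
    rwa [Module.End.mul_apply, Module.End.mul_apply, constMap_of_ne hd0, constMap_of_ne hd0] at this
  -- The identity sends `(a, b, d)` below itself, so `e` does too. As `e (a + b) = e d ≤ d`, the
  -- triple `(a, b, a + b)` passes for `e`, hence for the identity, which forces `a + b ≤ d`.
  have h1 := ((he a b d hd).2 ⟨le_rfl, le_rfl, le_rfl⟩)
  have h2 := ((he a b (a + b) le_rfl).1 ⟨h1.1, h1.2.1, hed ▸ h1.2.2⟩).2.2
  exact hne (le_antisymm hd h2)

/-- The congruence used is eventual agreement of the conditions `f x ≤ a m`. If `e` agrees with `1`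
from `n` on and `x, y` agree after `n`, their constant maps are congruent, so `e x = e y` and they
also agree at `n`. -/
theorem exists_separation_of_isRightCPSemiring
    (h : IsRightCPSemiring (Module.End BoolSemifield X)) (a : ℕ → X) :
    ∃ n, ∀ x y : X, (∀ m, n < m → (x ≤ a m ↔ y ≤ a m)) → (x ≤ a n ↔ y ≤ a n) := by
  rw [isRightCPSemiring_iff] at h
  obtain ⟨e, ⟨n, hn⟩, hk⟩ := h (rightCon
    (fun f g => ∃ n, ∀ m, n ≤ m → ∀ x, (f x ≤ a m ↔ g x ≤ a m))
    ⟨fun _ => ⟨0, fun _ _ _ => Iff.rfl⟩, fun ⟨n, h⟩ => ⟨n, fun m hm x => (h m hm x).symm⟩,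
      fun ⟨n, h⟩ ⟨n', h'⟩ => ⟨max n n', fun m hm x =>
        (h m (le_of_max_le_left hm) x).trans (h' m (le_of_max_le_right hm) x)⟩⟩
    (fun ⟨n, h⟩ ⟨n', h'⟩ => ⟨max n n', fun m hm x => by
      simp only [LinearMap.add_apply, add_le_natural]
      rw [h m (le_of_max_le_left hm) x, h' m (le_of_max_le_right hm) x]⟩)
    (fun s f g ⟨n, h⟩ => ⟨n, fun m hm x => h m hm (s x)⟩))
  refine ⟨n, fun x y hxy => ?_⟩
  have hfg : e * constMap x = e * constMap y := by
    apply hk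
    refine ⟨n + 1, fun m hm t => ?_⟩
    by_cases ht : t = 0
    · rw [ht, constMap_zero, constMap_zero]
    · rw [constMap_of_ne ht, constMap_of_ne ht]
      exact hxy m hm
  have hexy : e x = e y := by
    by_cases h0 : ∃ t : X, t ≠ 0
    · obtain ⟨t, ht⟩ := h0
      have := LinearMap.congr_fun hfg t
      rwa [Module.End.mul_apply, Module.End.mul_apply, constMap_of_ne ht, constMap_of_ne ht] at this
    · push Not at h0
      rw [h0 x, h0 y]
  have h1 : ∀ x, e x ≤ a n ↔ x ≤ a n := hn n le_rfl
  rw [← h1, hexy, h1]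

/-- In a semilattice with small joins, an element is incomparable to at most one element. -/
theorem HasSmallJoins.eq_of_incomparable (h : HasSmallJoins X) {a x y : X}
    (hax : ¬ a ≤ x) (hxa : ¬ x ≤ a) (hay : ¬ a ≤ y) (hya : ¬ y ≤ a) : x = y := by
  -- two incomparable elements below `x` and `a` cannot be nested
  have nested : ∀ {a b x : X}, ¬ a ≤ x → ¬ x ≤ a → ¬ b ≤ a → b ≤ x → b = x := by
    intro a b x hax hxa hba hbx
    by_contra hne
    have hab : ¬ a ≤ b := fun h' => hax (h'.trans hbx)
    have h1 : ¬ x ≤ a + b := by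
      intro h'
      rcases eq_or_ne x (a + b) with h2 | h2
      · exact hax (h2 ▸ le_add_natural_left a b)
      · rcases h a b x h' h2 with h3 | h3
        · exact hxa h3
        · exact hne (le_antisymm hbx h3)
    have h2 : a + b ≤ a + x :=
      add_le_natural.2 ⟨le_add_natural_left a x, hbx.trans (le_add_natural_right a x)⟩
    have h3 : a + b ≠ a + x := fun h' => h1 (h' ▸ le_add_natural_right a x)
    -- With `b < x`, the elements would span a pentagon: `a + b` lies strictly below `a + x` but
    -- below neither `a` nor `x`.
    rcases h a x (a + b) h2 h3 with h4 | h4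
    · exact hba ((le_add_natural_right a b).trans h4)
    · exact hax ((le_add_natural_left a b).trans h4)
  by_cases h1 : y ≤ x
  · exact (nested hax hxa hya h1).symm
  by_cases h2 : x ≤ y
  · exact nested hay hya hxa h2
  -- now `a, x, y` is an antichain
  exfalso
  have h3 : ¬ y ≤ a + x := by
    intro h'
    rcases eq_or_ne y (a + x) with h4 | h4
    · exact hay (h4 ▸ le_add_natural_left a x)
    · rcases h a x y h' h4 with h5 | h5
      · exact hya h5
      · exact h1 h5
  have h4 : ¬ a + x ≤ y := fun h' => hay ((le_add_natural_left a x).trans h')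
  have h5 : a = a + x := nested (a := y) h3 h4 hay (le_add_natural_left a x)
  exact hxa (h5 ▸ le_add_natural_right a x)

/-- By Ramsey, an infinite `X` contains an infinite strictly increasing sequence, strictly
decreasing sequence or antichain. Separation excludes the first two, small joins the third. -/
theorem finite_of_isRightCPSemiring
    (h : IsRightCPSemiring (Module.End BoolSemifield X)) : Finite X := by
  have hs := hasSmallJoins_of_isRightCPSemiring h
  by_contra hX
  rw [not_finite_iff_infinite] at hX
  let a : ℕ → X := Infinite.natEmbedding X
  have ha : Function.Injective a := (Infinite.natEmbedding X).injective
  obtain ⟨g, hg | hg⟩ := exists_increasing_or_nonincreasing_subseq (· < ·) a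
  · obtain ⟨n, hn⟩ := exists_separation_of_isRightCPSemiring h (fun m => a (g m))
    refine (hg n (n + 1) n.lt_succ_self).not_ge ((hn (a (g n)) (a (g (n + 1))) fun m hm => ?_).1
      le_rfl)
    refine iff_of_true (hg n m hm).le ?_
    rcases (Nat.succ_le_of_lt hm).eq_or_lt with h' | h'
    · exact h' ▸ le_rfl
    · exact (hg _ _ h').le
  · obtain ⟨k, hk | hk⟩ := exists_increasing_or_nonincreasing_subseq (· > ·) (fun n => a (g n))
    -- The shift by one ensures that the term at the index `n` has a predecessor in the decreasing
    -- sequence, to be compared with it.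
    · obtain ⟨n, hn⟩ := exists_separation_of_isRightCPSemiring h (fun m => a (g (k (m + 1))))
      have h1 : ∀ m m', m < m' → a (g (k m')) < a (g (k m)) := hk
      refine (h1 n (n + 1) n.lt_succ_self).not_ge ((hn (a (g (k (n + 1)))) (a (g (k n)))
        fun m hm => ?_).1 le_rfl)
      exact iff_of_false (h1 (n + 1) (m + 1) (by omega)).not_ge (h1 n (m + 1) (by omega)).not_ge
    · have h1 : ∀ m m', m < m' → ¬ a (g (k m)) ≤ a (g (k m')) ∧ ¬ a (g (k m')) ≤ a (g (k m)) := by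
        intro m m' hm
        have hkm : k m < k m' := k.strictMono hm
        have hne : a (g (k m)) ≠ a (g (k m')) :=
          fun h' => hkm.ne (g.injective (ha h'))
        exact ⟨fun h' => hg _ _ hkm (lt_of_le_of_ne h' hne),
          fun h' => hk _ _ hm (lt_of_le_of_ne h' hne.symm)⟩
      have h2 := hs.eq_of_incomparable (h1 0 1 one_pos).1 (h1 0 1 one_pos).2
        (h1 0 2 two_pos).1 (h1 0 2 two_pos).2
      exact absurd (k.injective (g.injective (ha h2))) (by norm_num)

/-! ### Distributivity -/

theorem exists_meet_of_finite [Finite X] (a b : X) :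
    ∃ m : X, m ≤ a ∧ m ≤ b ∧ ∀ z, z ≤ a → z ≤ b → z ≤ m := by
  classical
  have := Fintype.ofFinite X
  let _ : OrderBot X := { bot := 0, bot_le := zero_le_natural }
  refine ⟨(Finset.univ.filter fun z => z ≤ a ∧ z ≤ b).sup id, ?_, ?_, fun z ha hb => ?_⟩
  · exact Finset.sup_le fun z hz => (Finset.mem_filter.1 hz).2.1
  · exact Finset.sup_le fun z hz => (Finset.mem_filter.1 hz).2.2
  · exact Finset.le_sup (f := id) (Finset.mem_filter.2 ⟨Finset.mem_univ z, ha, hb⟩)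

/-- Distributivity as a decomposition property of the join alone: in one direction the pieces of `z`
are its meets with `a` and `b`; in the other, pieces of `a ∧ (b + c)` lie below the two smaller
meets. -/
theorem isDistributiveLattice_iff :
    IsDistributiveLattice X ↔
      (∀ a b : X, ∃ m : X, m ≤ a ∧ m ≤ b ∧ ∀ z, z ≤ a → z ≤ b → z ≤ m) ∧
        ∀ a b z : X, z ≤ a + b → ∃ x ≤ a, ∃ y ≤ b, z = x + y := by
  constructor
  · rintro ⟨L, hL⟩
    have hle : ∀ x y : X, L.le x y ↔ (naturalOrder X).le x y := fun x y => by
      rw [hL]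
    have hsup : ∀ x y : X, L.sup x y = x + y := fun x y =>
      (naturalOrder X).le_antisymm _ _
        ((hle _ _).1 (L.sup_le _ _ _ ((hle _ _).2 (le_add_natural_left x y))
          ((hle _ _).2 (le_add_natural_right x y))))
        (add_le_natural.2
          ⟨(hle _ _).1 (L.le_sup_left x y), (hle _ _).1 (L.le_sup_right x y)⟩)
    refine ⟨fun a b => ⟨L.inf a b, (hle _ _).1 (L.inf_le_left a b), (hle _ _).1 (L.inf_le_right a b),
      fun z ha hb => (hle _ _).1 (L.le_inf _ _ _ ((hle _ _).2 ha) ((hle _ _).2 hb))⟩,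
      fun a b z hz => ⟨L.inf z a, (hle _ _).1 (L.inf_le_right z a), L.inf z b,
        (hle _ _).1 (L.inf_le_right z b), ?_⟩⟩
    rw [← hsup]
    have h1 : L.inf z (L.sup a b) = z := by
      rw [hsup]
      exact @inf_eq_left X L.toSemilatticeInf z (a + b) |>.2 ((hle _ _).2 hz)
    exact h1.symm.trans (@inf_sup_left X L z a b)
  · rintro ⟨hm, hd⟩
    choose inf hl hr hg using hm
    let L : Lattice X :=
      { joinSemilattice X with
        inf := inf
        inf_le_left := hl
        inf_le_right := hr
        le_inf := fun z a b ha hb => hg a b z ha hb }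
    refine ⟨@DistribLattice.ofInfSupLe X L fun a b c => ?_, rfl⟩
    change inf a (b + c) ≤ inf a b + inf a c
    obtain ⟨x, hx, y, hy, hz⟩ := hd b c (inf a (b + c)) (hr a (b + c))
    have ha := hl a (b + c)
    rw [hz] at ha ⊢
    rw [add_le_natural] at ha ⊢
    exact ⟨(hg a b x ha.1 hx).trans (le_add_natural_left _ _),
      (hg a c y ha.2 hy).trans (le_add_natural_right _ _)⟩

theorem HasSmallJoins.isDistributiveLattice [Finite X] (h : HasSmallJoins X) :
    IsDistributiveLattice X := by
  refine isDistributiveLattice_iff.2 ⟨exists_meet_of_finite, fun a b z hz => ?_⟩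
  rcases eq_or_ne z (a + b) with h1 | h1
  · exact ⟨a, le_rfl, b, le_rfl, h1⟩
  · rcases h a b z hz h1 with h2 | h2
    · exact ⟨z, h2, 0, zero_le_natural b, (add_zero z).symm⟩
    · exact ⟨0, zero_le_natural a, z, h2, (zero_add z).symm⟩

/-! ### Quotients -/

/-- An element incomparable to `a + b` is not above both summands. It is then incomparable to one of
them, and so equals the other by uniqueness. -/
theorem HasSmallJoins.add_mem_comparableElements (h : HasSmallJoins X) {a b : X} (hab : ¬ a ≤ b)
    (hba : ¬ b ≤ a) : a + b ∈ comparableElements X := by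
  intro y
  by_contra! hy
  have key : ∀ {a b : X}, ¬ a ≤ b → ¬ b ≤ a → ¬ y ≤ a + b → ¬ a ≤ y → False := by
    intro a b hab hba hy ha
    have h1 : b = y := h.eq_of_incomparable hab hba ha
      fun h' => hy (h'.trans (le_add_natural_left a b))
    exact hy (h1 ▸ le_add_natural_right a b)
  by_cases ha : a ≤ y
  · refine key (a := b) (b := a) hba hab (by rw [add_comm]; exact hy.1) fun hb => hy.2 ?_
    exact add_le_natural.2 ⟨ha, hb⟩
  · exact key hab hba hy.1 ha

theorem HasSmallJoins.meet_mem_comparableElements (h : HasSmallJoins X) {a b m : X} (hab : ¬ a ≤ b)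
    (hba : ¬ b ≤ a) (hma : m ≤ a) (hmb : m ≤ b) (hm : ∀ z, z ≤ a → z ≤ b → z ≤ m) :
    m ∈ comparableElements X := by
  intro y
  by_contra! hy
  have key : ∀ {a b : X}, ¬ a ≤ b → ¬ b ≤ a → m ≤ a → m ≤ b → ¬ y ≤ a → False := by
    intro a b hab hba hma hmb ha
    have h1 : b = y := h.eq_of_incomparable hab hba (fun h' => hy.2 (hma.trans h')) ha
    exact hy.2 (h1 ▸ hmb)
  by_cases ha : y ≤ a
  · exact key hba hab hmb hma fun hb => hy.1 (hm y ha hb)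
  · exact key hab hba hma hmb ha

/-- For incomparable lifts `a, b`, the join `a + b` is comparable to every lift `d`. If `d` is below
it, small joins apply upstairs; if above, the images of `d` and `a + b` coincide. -/
theorem HasSmallJoins.of_surjective (h : HasSmallJoins X) {Y : Type*} [AddCommMonoid Y]
    [Module BoolSemifield Y] (f : X →ₗ[BoolSemifield] Y) (hf : Function.Surjective f) :
    HasSmallJoins Y := by
  intro a b d hd hne
  obtain ⟨a, rfl⟩ := hf a
  obtain ⟨b, rfl⟩ := hf b
  obtain ⟨d, rfl⟩ := hf d
  rw [← map_add] at hd hne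
  by_cases hab : a ≤ b
  · rw [natural_le_iff.1 hab] at hd
    exact Or.inr hd
  by_cases hba : b ≤ a
  · rw [add_comm, natural_le_iff.1 hba] at hd
    exact Or.inl hd
  rcases h.add_mem_comparableElements hab hba d with h1 | h1
  · exact (h a b d h1 fun h' => hne (congrArg f h')).imp (map_natural_mono f) (map_natural_mono f)
  · exact absurd (le_antisymm hd (map_natural_mono f h1)) hne

theorem HasSmallJoins.allQuotientsDistributive [Finite X] (h : HasSmallJoins X) :
    AllQuotientsDistributive X := by
  intro θ
  have : Finite θ.Quotient := Finite.of_surjective _ θ.mkLinear_surjective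
  exact (h.of_surjective θ.mkLinear θ.mkLinear_surjective).isDistributiveLattice

/-- A congruence on a `𝐁`-semimodule, from the properties of its relation. -/
def boolCon (r : X → X → Prop) (hr : Equivalence r)
    (hadd : ∀ {x y x' y' : X}, r x y → r x' y' → r (x + x') (y + y')) :
    ModuleCon BoolSemifield X where
  r := r
  iseqv := hr
  add' := hadd
  smul := by
    rintro (_ | _) x y h
    · change r ((0 : BoolSemifield) • x) ((0 : BoolSemifield) • y)
      rw [zero_smul, zero_smul]
      exact hr.refl 0
    · change r ((1 : BoolSemifield) • x) ((1 : BoolSemifield) • y)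
      rwa [one_smul, one_smul]

/-! ### Join primes and splittings -/

/-- The nonzero elements `j` such that `j ≤ b + c` implies `j ≤ b` or `j ≤ c`. -/
def IsJoinPrime (j : X) : Prop := j ≠ 0 ∧ ∀ b c : X, j ≤ b + c → j ≤ b ∨ j ≤ c

theorem IsJoinPrime.not_le_zero {j : X} (hj : IsJoinPrime j) : ¬ j ≤ 0 :=
  fun h => hj.1 (natural_le_zero.1 h)

theorem IsJoinPrime.le_add_iff {j : X} (hj : IsJoinPrime j) (b c : X) :
    j ≤ b + c ↔ j ≤ b ∨ j ≤ c :=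
  ⟨hj.2 b c, fun h => h.elim (fun h => h.trans (le_add_natural_left b c))
    (fun h => h.trans (le_add_natural_right b c))⟩

/-- The linear map which sends the elements above the join prime `j` to `y`. -/
noncomputable def primeStep {Y : Type*} [AddCommMonoid Y] [Module BoolSemifield Y]
    (j : {j : X // IsJoinPrime j}) (y : Y) : X →ₗ[BoolSemifield] Y :=
  stepMap (fun t => (j : X) ≤ t) j.2.not_le_zero j.2.le_add_iff y

theorem map_primeStep {Y Z : Type*} [AddCommMonoid Y] [Module BoolSemifield Y] [AddCommMonoid Z]
    [Module BoolSemifield Z] (f : Y →ₗ[BoolSemifield] Z) (j : {j : X // IsJoinPrime j}) (y : Y)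
    (t : X) : f (primeStep j y t) = primeStep j (f y) t := by
  by_cases h : (j : X) ≤ t
  · exact (congrArg f (stepMap_of_pos h y)).trans (stepMap_of_pos h (f y)).symm
  · exact (congrArg f (stepMap_of_neg h y)).trans
      ((map_zero f).trans (stepMap_of_neg h (f y)).symm)

/-- Join primes determine the order: by distributivity, a nonzero element that is not join prime is
a sum of two strictly smaller ones, and induction applies. -/
theorem natural_le_of_joinPrime_le [Finite X] (hX : IsDistributiveLattice X) (x z : X)
    (h : ∀ j : X, IsJoinPrime j → j ≤ x → j ≤ z) : x ≤ z := by
  induction x using WellFoundedLT.induction with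
  | ind x ih =>
    by_cases h0 : x = 0
    · exact h0 ▸ zero_le_natural z
    by_cases hx : IsJoinPrime x
    · exact h x hx le_rfl
    have hx' : ∃ b c : X, x ≤ b + c ∧ ¬ x ≤ b ∧ ¬ x ≤ c := by
      by_contra! h'
      exact hx ⟨h0, fun b c hbc => or_iff_not_imp_left.2 (h' b c hbc)⟩
    obtain ⟨b, c, hbc, hb, hc⟩ := hx'
    obtain ⟨u, hu, v, hv, huv⟩ := (isDistributiveLattice_iff.1 hX).2 b c x hbc
    have hux : u ≤ x := huv ▸ le_add_natural_left u v
    have hvx : v ≤ x := huv ▸ le_add_natural_right u v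
    rw [huv]
    exact add_le_natural.2
      ⟨ih u (lt_of_le_of_ne hux fun h' => hb (h' ▸ hu)) fun j hj hju => h j hj (hju.trans hux),
        ih v (lt_of_le_of_ne hvx fun h' => hc (h' ▸ hv)) fun j hj hjv => h j hj (hjv.trans hvx)⟩

theorem sum_primeStep [Fintype {j : X // IsJoinPrime j}] [Finite X] (hX : IsDistributiveLattice X) :
    ∑ j : {j : X // IsJoinPrime j}, primeStep j (j : X) = LinearMap.id := by
  classical
  have hsum : ∀ (s : Finset {j : X // IsJoinPrime j}) (f : {j : X // IsJoinPrime j} → X) (z : X),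
      ∑ j ∈ s, f j ≤ z ↔ ∀ j ∈ s, f j ≤ z := by
    intro s f z
    induction s using Finset.induction_on with
    | empty => simp [zero_le_natural]
    | insert j s hj ih => rw [Finset.sum_insert hj, add_le_natural, ih, Finset.forall_mem_insert]
  ext x
  rw [LinearMap.sum_apply, LinearMap.id_apply]
  apply le_antisymm
  · rw [hsum]
    intro j _
    by_cases h : (j : X) ≤ x
    · exact (stepMap_of_pos h (j : X)).le.trans h
    · exact (stepMap_of_neg h (j : X)).le.trans (zero_le_natural x)
  · refine natural_le_of_joinPrime_le hX _ _ fun j hj hjx => ?_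
    have h1 := (hsum Finset.univ (fun i => primeStep i (i : X) x) _).1 le_rfl ⟨j, hj⟩
      (Finset.mem_univ _)
    exact (stepMap_of_pos (p := fun t => j ≤ t) hjx j).ge.trans h1

/-- Finite distributive lattices are projective `𝐁`-semimodules. -/
theorem IsDistributiveLattice.exists_section {Y : Type*} [AddCommMonoid Y] [Module BoolSemifield Y]
    [Finite X] (hX : IsDistributiveLattice X) (π : Y →ₗ[BoolSemifield] X)
    (hπ : Function.Surjective π) : ∃ σ : X →ₗ[BoolSemifield] Y, ∀ x, π (σ x) = x := by
  have := Fintype.ofFinite {j : X // IsJoinPrime j}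
  -- The section sends `x` to the sum of chosen lifts of the join primes below `x`; no compatibility
  -- between the lifts is needed.
  refine ⟨∑ j : {j : X // IsJoinPrime j}, primeStep j (Function.surjInv hπ (j : X)), fun x => ?_⟩
  rw [LinearMap.sum_apply, map_sum]
  simp only [map_primeStep, Function.surjInv_eq]
  rw [← LinearMap.sum_apply, sum_primeStep hX, LinearMap.id_apply]

theorem constMap_add (x y : X) : constMap (x + y) = constMap x + constMap y := by
  ext t
  rw [LinearMap.add_apply]
  by_cases ht : t = 0
  · rw [ht, constMap_zero, constMap_zero, constMap_zero, add_zero]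
  · rw [constMap_of_ne ht, constMap_of_ne ht, constMap_of_ne ht]

theorem mul_constMap (f : Module.End BoolSemifield X) (x : X) :
    f * constMap x = constMap (f x) := by
  ext t
  rw [Module.End.mul_apply]
  by_cases ht : t = 0
  · rw [ht, constMap_zero, constMap_zero, map_zero]
  · rw [constMap_of_ne ht, constMap_of_ne ht]

theorem constMap_mul_primeStep (j : {j : X // IsJoinPrime j}) (x : X) :
    constMap x * (primeStep j (j : X) : Module.End BoolSemifield X) = primeStep j x := by
  ext t
  rw [Module.End.mul_apply, map_primeStep, constMap_of_ne j.2.1]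

/-- Since `f` is the sum over join primes `j` of `constMap (f j)` times `primeStep j j`, a right
congruence `c` is pointwise congruence modulo `θ`. If `σ` is a section of the projection `π` onto
`X/θ`, then `σ ∘ π` is the required `e`. -/
theorem isRightCPSemiring_of_allQuotientsDistributive [Finite X] (hX : IsDistributiveLattice X)
    (h : AllQuotientsDistributive X) : IsRightCPSemiring (Module.End BoolSemifield X) := by
  rw [isRightCPSemiring_iff]
  intro c
  have := Fintype.ofFinite {j : X // IsJoinPrime j}
  let θ : ModuleCon BoolSemifield X := boolCon (fun x y => c.r (constMap x) (constMap y))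
    ⟨fun _ => c.iseqv.refl _, fun h => c.iseqv.symm h, fun h h' => c.iseqv.trans h h'⟩
    (fun h h' => by rw [constMap_add, constMap_add]; exact c.add' h h')
  have hθ : ∀ x y, θ.mkLinear x = θ.mkLinear y ↔ c.r (constMap x) (constMap y) :=
    fun x y => θ.mkLinear_eq_iff
  have hc : ∀ f g, c.r f g ↔ ∀ x, θ.mkLinear (f x) = θ.mkLinear (g x) := by
    intro f g
    constructor
    · intro hfg x
      rw [hθ, ← mul_constMap, ← mul_constMap]
      exact c.smul (MulOpposite.op (constMap x)) hfg
    · intro hfg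
      have hdec : ∀ f : Module.End BoolSemifield X, f = ∑ j : {j : X // IsJoinPrime j},
          MulOpposite.op (primeStep j (j : X) : Module.End BoolSemifield X) •
            constMap (f (j : X)) := by
        intro f
        conv_lhs => rw [← mul_one f, ← show _ = (1 : Module.End BoolSemifield X) from
          sum_primeStep hX, Finset.mul_sum]
        refine Finset.sum_congr rfl fun j _ => ?_
        rw [op_smul_eq_mul, constMap_mul_primeStep]
        ext t
        rw [Module.End.mul_apply, map_primeStep]
      rw [← c.mkLinear_eq_iff, hdec f, hdec g, map_sum, map_sum]
      refine Finset.sum_congr rfl fun j _ => ?_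
      rw [map_smul, map_smul, c.mkLinear_eq_iff.2 ((hθ _ _).1 (hfg j))]
  have : Finite θ.Quotient := Finite.of_surjective _ θ.mkLinear_surjective
  obtain ⟨σ, hσ⟩ := (h θ).exists_section θ.mkLinear θ.mkLinear_surjective
  refine ⟨σ ∘ₗ θ.mkLinear, (hc _ _).2 fun x => hσ _, fun f g hfg => LinearMap.ext fun x => ?_⟩
  exact congrArg σ ((hc f g).1 hfg x)

/-! ### Small steps -/

theorem nonempty_orderIso_bool_prod {α : Type*} [PartialOrder α] {t x y t' : α} (ht : ∀ z, t ≤ z)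
    (ht' : ∀ z, z ≤ t') (hxy : ¬ x ≤ y) (hyx : ¬ y ≤ x)
    (h : ∀ z, z = t ∨ z = x ∨ z = y ∨ z = t') : Nonempty (α ≃o Bool × Bool) := by
  let f : Bool × Bool → α := fun p => bif p.1 then (bif p.2 then t' else x)
    else (bif p.2 then y else t)
  have hxt : ¬ x ≤ t := fun h' => hxy (h'.trans (ht y))
  have hyt : ¬ y ≤ t := fun h' => hyx (h'.trans (ht x))
  have htx : ¬ t' ≤ x := fun h' => hyx ((ht' y).trans h')
  have hty : ¬ t' ≤ y := fun h' => hxy ((ht' x).trans h')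
  have htt : ¬ t' ≤ t := fun h' => htx (h'.trans (ht x))
  have hf : ∀ {p q}, f p ≤ f q ↔ p ≤ q := by
    rintro ⟨_ | _, _ | _⟩ ⟨_ | _, _ | _⟩ <;>
      simp [f, ht, ht', hxy, hyx, hxt, hyt, htx, hty, htt]
  have hs : Function.Surjective f := by
    intro z
    rcases h z with h | h | h | h
    · exact ⟨(false, false), h.symm⟩
    · exact ⟨(true, false), h.symm⟩
    · exact ⟨(false, true), h.symm⟩
    · exact ⟨(true, true), h.symm⟩
  exact ⟨(RelIso.ofSurjective (OrderEmbedding.ofMapLEIff f fun _ _ => hf) hs).symm⟩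

/-- An interior point `x` of the interval has a unique incomparable partner `y`. Their join and meet
lie in `T(X)`, hence are the endpoints, and uniqueness of partners leaves no room for a fifth
element. -/
theorem HasSmallJoins.hasSmallSteps [Finite X] (h : HasSmallJoins X) : HasSmallSteps X := by
  intro t ht t' ht' htt hI
  by_cases hx : ∃ x ∈ Set.Icc t t', x ≠ t ∧ x ≠ t'
  · right
    have hT : ∀ {x : X}, x ∈ Set.Icc t t' → x ∈ comparableElements X → x = t ∨ x = t' := by
      intro x hx hxT
      have : x ∈ ({t, t'} : Set X) := hI ▸ ⟨hx, hxT⟩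
      simpa using this
    obtain ⟨x, hx, hxt, hxt'⟩ := hx
    have hxT : x ∉ comparableElements X := fun h' => (hT hx h').elim hxt hxt'
    have hy : ∃ y : X, ¬ y ≤ x ∧ ¬ x ≤ y := by
      by_contra! h'
      exact hxT fun y => or_iff_not_imp_left.2 (h' y)
    obtain ⟨y, hyx, hxy⟩ := hy
    have hy : y ∈ Set.Icc t t' :=
      ⟨(ht y).resolve_left fun h' => hyx (h'.trans hx.1),
        (ht' y).resolve_right fun h' => hxy (hx.2.trans h')⟩
    have hsup : x + y = t' := by
      refine (hT ⟨hx.1.trans (le_add_natural_left x y), add_le_natural.2 ⟨hx.2, hy.2⟩⟩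
        (h.add_mem_comparableElements hxy hyx)).resolve_left fun h' => hxt ?_
      exact le_antisymm (h' ▸ le_add_natural_left x y) hx.1
    obtain ⟨m, hmx, hmy, hm⟩ := exists_meet_of_finite x y
    have hmt : m = t := by
      refine (hT ⟨hm t hx.1 hy.1, hmx.trans hx.2⟩
        (h.meet_mem_comparableElements hxy hyx hmx hmy hm)).resolve_right fun h' => hxt' ?_
      exact le_antisymm hx.2 (h' ▸ hmx)
    refine nonempty_orderIso_bool_prod (t := ⟨t, le_rfl, htt⟩) (x := ⟨x, hx⟩) (y := ⟨y, hy⟩)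
      (t' := ⟨t', htt, le_rfl⟩) (fun z => z.2.1) (fun z => z.2.2) hxy hyx ?_
    rintro ⟨z, hz⟩
    simp only [Subtype.mk.injEq]
    by_cases hzx : z ≤ x
    · by_cases hzy : z ≤ y
      · exact Or.inl (le_antisymm ((hm z hzx hzy).trans hmt.le) hz.1)
      · by_cases hyz : y ≤ z
        · exact absurd (hyz.trans hzx) hyx
        · exact Or.inr (Or.inl (h.eq_of_incomparable hyz hzy hyx hxy))
    · by_cases hxz : x ≤ z
      · by_cases hyz : y ≤ z
        · exact Or.inr (Or.inr (Or.inr (le_antisymm hz.2 (hsup.ge.trans (add_le_natural.2 ⟨hxz, hyz⟩)))))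
        · by_cases hzy : z ≤ y
          · exact absurd (hxz.trans hzy) hxy
          · exact Or.inr (Or.inl (h.eq_of_incomparable hyz hzy hyx hxy))
      · exact Or.inr (Or.inr (Or.inl (h.eq_of_incomparable hxz hzx hxy hyx)))
  · left
    push Not at hx
    ext z
    simp only [Set.mem_insert_iff, Set.mem_singleton_iff]
    constructor
    · exact fun hz => or_iff_not_imp_left.2 (hx z hz)
    · rintro (rfl | rfl)
      · exact ⟨le_rfl, htt⟩
      · exact ⟨htt, le_rfl⟩

theorem bool_prod_le_or_top : ∀ p q r : Bool × Bool, ¬ p ≤ q → ¬ q ≤ p →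
    r ≤ p ∨ r ≤ q ∨ ∀ s, s ≤ r := by
  simp only [Prod.forall, Prod.mk_le_mk]
  decide

/-- Incomparable `a, b` lie in a single step, from the largest element of `T(X)` below both to the
smallest above both. This step must be `𝐁²`, where an element below neither atom is the top. -/
theorem HasSmallSteps.hasSmallJoins [Finite X] (h : HasSmallSteps X) : HasSmallJoins X := by
  intro a b d hd hne
  by_contra! hab
  have hab' : ¬ a ≤ b := fun h' => hab.2 (natural_le_iff.1 h' ▸ hd)
  have hba' : ¬ b ≤ a := fun h' => hab.1 (natural_le_iff.1 h' ▸ add_comm a b ▸ hd)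
  have htop : ∃ z : X, ∀ x, x ≤ z := by
    classical
    have := Fintype.ofFinite X
    let _ : OrderBot X := { bot := 0, bot_le := zero_le_natural }
    exact ⟨Finset.univ.sup id, fun x => Finset.le_sup (f := id) (Finset.mem_univ x)⟩
  obtain ⟨z, hz⟩ := htop
  obtain ⟨t, ⟨htT, hta, htb⟩, ht⟩ := (Set.toFinite
    {u : X | u ∈ comparableElements X ∧ u ≤ a ∧ u ≤ b}).exists_maximal
    ⟨0, fun x => Or.inr (zero_le_natural x), zero_le_natural a, zero_le_natural b⟩
  obtain ⟨t', ⟨htT', hta', htb'⟩, ht'⟩ := (Set.toFinite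
    {u : X | u ∈ comparableElements X ∧ a ≤ u ∧ b ≤ u}).exists_minimal
    ⟨z, fun x => Or.inl (hz x), hz a, hz b⟩
  have htt : t ≤ t' := hta.trans hta'
  have hI : Set.Icc t t' ∩ comparableElements X = {t, t'} := by
    ext u
    simp only [Set.mem_inter_iff, Set.mem_insert_iff, Set.mem_singleton_iff]
    constructor
    · rintro ⟨⟨hu, hu'⟩, huT⟩
      rcases huT a with h1 | h1
      · have h2 : b ≤ u := (huT b).resolve_right fun h2 => hab' (h1.trans h2)
        exact Or.inr (le_antisymm hu' (ht' ⟨huT, h1, h2⟩ hu'))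
      · have h2 : u ≤ b := (huT b).resolve_left fun h2 => hba' (h2.trans h1)
        exact Or.inl (le_antisymm (ht ⟨huT, h1, h2⟩ hu) hu)
    · rintro (rfl | rfl)
      · exact ⟨⟨le_rfl, htt⟩, htT⟩
      · exact ⟨⟨htt, le_rfl⟩, htT'⟩
  have ha : a ∈ Set.Icc t t' := ⟨hta, hta'⟩
  have hb : b ∈ Set.Icc t t' := ⟨htb, htb'⟩
  rcases h t htT t' htT' htt hI with h1 | ⟨⟨φ⟩⟩
  · rw [h1] at ha
    rcases ha with h2 | h2
    · exact hab' (h2 ▸ htb)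
    · rw [Set.mem_singleton_iff] at h2
      exact hba' (h2 ▸ htb')
  · have hd' : d ∈ Set.Icc t t' :=
      ⟨(htT d).resolve_left fun h' => hab.1 (h'.trans hta),
        hd.trans (add_le_natural.2 ⟨hta', htb'⟩)⟩
    have hφ : ∀ x y : Set.Icc t t', φ x ≤ φ y ↔ (x : X) ≤ y := fun x y => φ.le_iff_le
    rcases bool_prod_le_or_top (φ ⟨a, ha⟩) (φ ⟨b, hb⟩) (φ ⟨d, hd'⟩)
      (fun h' => hab' ((hφ _ _).1 h')) (fun h' => hba' ((hφ _ _).1 h')) with h2 | h2 | h2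
    · exact hab.1 ((hφ _ _).1 h2)
    · exact hab.2 ((hφ _ _).1 h2)
    · exact hne (le_antisymm hd (add_le_natural.2
        ⟨(hφ ⟨a, ha⟩ ⟨d, hd'⟩).1 (h2 _), (hφ ⟨b, hb⟩ ⟨d, hd'⟩).1 (h2 _)⟩))

end Semilattice

/-! ### Semimodules over Boolean algebras -/

theorem finite_of_wellFoundedGT_booleanAlgebra (C : Type*) [BooleanAlgebra C] [WellFoundedGT C] :
    Finite C := by
  have : WellFoundedLT C := ⟨(InvImage.wf (fun c : C => cᶜ) (wellFounded_gt (α := C))).mono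
    fun a b h => compl_lt_compl_iff_lt.2 h⟩
  have key : ∀ c : C, (Set.Iic c).Finite := by
    intro c
    induction c using WellFoundedLT.induction with
    | ind c ih =>
      by_cases h : ∃ b, b ≤ c ∧ b ≠ ⊥ ∧ b ≠ c
      · obtain ⟨b, hbc, hb, hb'⟩ := h
        -- A proper nonzero `b < c` splits every `d ≤ c` into a part below `b` and a part below `c \
        -- b`.
        refine ((((ih b (lt_of_le_of_ne hbc hb')).prod (ih (c \ b) ?_)).image
          fun p => p.1 ⊔ p.2)).subset fun d hd => ?_
        · refine lt_of_le_of_ne sdiff_le fun h' => hb ?_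
          rw [sdiff_eq_left] at h'
          exact disjoint_self.1 (h'.mono_left hbc)
        · refine ⟨(d ⊓ b, d \ b), ⟨inf_le_right, sdiff_le_sdiff_right hd⟩, ?_⟩
          exact sup_inf_sdiff d b
      · push Not at h
        refine (Set.toFinite {⊥, c}).subset fun d hd => ?_
        by_cases h0 : d = ⊥
        · exact Or.inl h0
        · exact Or.inr (h d hd h0)
  have := (key ⊤)
  rw [Set.Iic_top] at this
  exact Set.finite_univ_iff.1 this

section Semimodule

variable {B : Type u} [BooleanAlgebra B] {M : Type v} [AddCommMonoid M] [Module (BoolSemiring B) M]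

theorem AnnQuotient.eq_zero_of_smul_eq_zero {c : AnnQuotient B M} (h : ∀ m : M, c • m = 0) :
    c = 0 := by
  induction c using Quotient.inductionOn' with
  | h b =>
    have hb : b ∈ Module.annihilator (BoolSemiring B) M := Module.mem_annihilator.2 h
    exact Quotient.sound' ⟨0, zero_mem _, b, hb, by rw [add_zero, zero_add]⟩

theorem map_annQuotient_smul (f : Module.End (BoolSemiring B) M) (c : AnnQuotient B M) (m : M) :
    f (c • m) = c • f m := by
  induction c using Quotient.inductionOn' with
  | h b => exact map_smul f b m

theorem annQuotient_smul_comm (b : BoolSemiring B) (c : AnnQuotient B M) (m : M) :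
    c • b • m = b • c • m := by
  rw [← AnnQuotient.coe_smul, ← AnnQuotient.coe_smul, ← mul_smul, ← mul_smul, mul_comm]

/-- The action of an element of `B/J` as an endomorphism. -/
def annSMulEnd (c : AnnQuotient B M) : Module.End (BoolSemiring B) M where
  toFun m := c • m
  map_add' := smul_add c
  map_smul' b m := annQuotient_smul_comm b c m

theorem annSMulEnd_apply (c : AnnQuotient B M) (m : M) : annSMulEnd c m = c • m := rfl

theorem AnnQuotient.compl_mul_self (c : AnnQuotient B M) : cᶜ * c = 0 := compl_inf_eq_bot (a := c)

theorem AnnQuotient.compl_smul_eq_of_le {c d : AnnQuotient B M} (h : c ≤ d) {x y : M}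
    (hxy : cᶜ • x = cᶜ • y) : dᶜ • x = dᶜ • y := by
  have h1 : dᶜ = dᶜ * cᶜ := (inf_eq_left.2 (compl_le_compl h)).symm
  rw [h1, mul_smul, mul_smul, hxy]

/-- For an ascending chain `a`, call `f` and `g` congruent if they agree off some `a n`. Each action
of `a m` is congruent to `0`, hence killed by `e`, while `e` agrees with `1` off a fixed `a n`. As
`B/J` acts faithfully, `a m ≤ a n` for all `m ≥ n`. -/
theorem finite_annQuotient_of_isRightCPSemiring
    (h : IsRightCPSemiring (Module.End (BoolSemiring B) M)) : Finite (AnnQuotient B M) := by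
  rw [isRightCPSemiring_iff] at h
  have hwf : WellFoundedGT (AnnQuotient B M) := by
    rw [wellFoundedGT_iff_monotone_chain_condition]
    intro a
    obtain ⟨e, ⟨n, hn⟩, hk⟩ := h (rightCon
      (fun f g => ∃ n, ∀ x : M, (a n)ᶜ • f x = (a n)ᶜ • g x)
      ⟨fun _ => ⟨0, fun _ => rfl⟩, fun ⟨n, h⟩ => ⟨n, fun x => (h x).symm⟩,
        fun ⟨n, h⟩ ⟨n', h'⟩ => ⟨max n n', fun x =>
          (AnnQuotient.compl_smul_eq_of_le (a.monotone (le_max_left n n')) (h x)).trans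
            (AnnQuotient.compl_smul_eq_of_le (a.monotone (le_max_right n n')) (h' x))⟩⟩
      (fun ⟨n, h⟩ ⟨n', h'⟩ => ⟨max n n', fun x => by
        rw [LinearMap.add_apply, LinearMap.add_apply, smul_add, smul_add,
          AnnQuotient.compl_smul_eq_of_le (a.monotone (le_max_left n n')) (h x),
          AnnQuotient.compl_smul_eq_of_le (a.monotone (le_max_right n n')) (h' x)]⟩)
      (fun s f g ⟨n, h⟩ => ⟨n, fun x => h (s x)⟩))
    refine ⟨n, fun m hm => le_antisymm (a.monotone hm) ?_⟩
    have h0 : e * annSMulEnd (a m) = e * 0 := hk _ _ ⟨m, fun x => by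
      rw [annSMulEnd_apply, ← mul_smul, AnnQuotient.compl_mul_self, zero_smul,
        LinearMap.zero_apply, smul_zero]⟩
    have h1 : (a n)ᶜ * a m = 0 := by
      refine AnnQuotient.eq_zero_of_smul_eq_zero fun x => ?_
      have h2 : e (a m • x) = 0 := by
        rw [mul_zero] at h0
        exact LinearMap.congr_fun h0 x
      have h3 : (a n)ᶜ • e (a m • x) = (a n)ᶜ • (a m • x) := hn (a m • x)
      rw [mul_smul, ← h3, h2, smul_zero]
    have h2 : Disjoint (a m) (a n)ᶜ := by
      rw [disjoint_comm, disjoint_iff]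
      exact h1
    exact disjoint_compl_right_iff.1 h2
  exact finite_of_wellFoundedGT_booleanAlgebra _

/-! ### Components -/

theorem smul_mem_componentAt (a : AnnQuotient B M) (m : M) : a • m ∈ componentAt a := ⟨m, rfl⟩

theorem smul_of_mem_componentAt {a : AnnQuotient B M} {x : M} (hx : x ∈ componentAt a) :
    a • x = x := by
  obtain ⟨m, rfl⟩ := hx
  change a • a • m = a • m
  rw [← mul_smul]
  exact congrArg (· • m) (inf_idem a)

theorem map_mem_componentAt (f : Module.End (BoolSemiring B) M) {a : AnnQuotient B M} {x : M}
    (hx : x ∈ componentAt a) : f x ∈ componentAt a := by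
  rw [← smul_of_mem_componentAt hx, map_annQuotient_smul]
  exact smul_mem_componentAt a _

/-- The restriction of endomorphisms of `M` to the component `M a`. -/
def componentRestrict (a : AnnQuotient B M) :
    Module.End (BoolSemiring B) M →+* Module.End BoolSemifield (componentAt a) where
  toFun f := AddMonoidHom.toBoolLinear
    { toFun := fun x => ⟨f x, map_mem_componentAt f x.2⟩
      map_zero' := Subtype.ext (map_zero f)
      map_add' := fun x y => Subtype.ext (map_add f (x : M) y) }
  map_one' := rfl
  map_mul' _ _ := rfl
  map_zero' := rfl
  map_add' _ _ := rfl

/-- The product of `b` with an atom is zero or the atom. Hence additive maps on `M a` are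
automatically `B`-linear, which makes `componentExtend` well defined. -/
theorem smul_eq_zero_or_self_of_isAtom {a : AnnQuotient B M} (ha : IsAtom a) (b : BoolSemiring B) :
    (∀ x ∈ componentAt a, b • x = 0) ∨ ∀ x ∈ componentAt a, b • x = x := by
  have hb : ∀ x ∈ componentAt a, b • x = ((b : AnnQuotient B M) * a) • x := fun x hx => by
    rw [mul_smul, smul_of_mem_componentAt hx, AnnQuotient.coe_smul]
  rcases ha.le_iff.1 (inf_le_right : (b : AnnQuotient B M) ⊓ a ≤ a) with h | h
  · refine Or.inl fun x hx => ?_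
    rw [hb x hx]
    exact (congrArg (· • x) h).trans (zero_smul _ x)
  · refine Or.inr fun x hx => ?_
    rw [hb x hx]
    exact (congrArg (· • x) h).trans (smul_of_mem_componentAt hx)

/-- The extension by zero of endomorphisms of the component `M a`, for an atom `a`. -/
def componentExtend {a : AnnQuotient B M} (ha : IsAtom a)
    (g : Module.End BoolSemifield (componentAt a)) : Module.End (BoolSemiring B) M where
  toFun m := g ⟨a • m, smul_mem_componentAt a m⟩
  map_add' m n := by
    have h : (⟨a • (m + n), smul_mem_componentAt a _⟩ : componentAt a) =
        ⟨a • m, smul_mem_componentAt a m⟩ + ⟨a • n, smul_mem_componentAt a n⟩ :=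
      Subtype.ext (smul_add a m n)
    rw [h, map_add]
    rfl
  map_smul' b m := by
    rw [RingHom.id_apply]
    rcases smul_eq_zero_or_self_of_isAtom ha b with h | h
    · have h1 : (⟨a • b • m, smul_mem_componentAt a _⟩ : componentAt a) = 0 := Subtype.ext (by
        change a • b • m = 0
        rw [annQuotient_smul_comm]
        exact h _ (smul_mem_componentAt a m))
      rw [h1, map_zero, h _ (Subtype.mem _)]
      rfl
    · have h1 : (⟨a • b • m, smul_mem_componentAt a _⟩ : componentAt a) =
          ⟨a • m, smul_mem_componentAt a m⟩ := Subtype.ext (by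
        change a • b • m = a • m
        rw [annQuotient_smul_comm]
        exact h _ (smul_mem_componentAt a m))
      rw [h1, h _ (Subtype.mem _)]

theorem componentExtend_apply {a : AnnQuotient B M} (ha : IsAtom a)
    (g : Module.End BoolSemifield (componentAt a)) (m : M) :
    componentExtend ha g m = g ⟨a • m, smul_mem_componentAt a m⟩ := rfl

theorem componentExtend_add {a : AnnQuotient B M} (ha : IsAtom a)
    (f g : Module.End BoolSemifield (componentAt a)) :
    componentExtend ha (f + g) = componentExtend ha f + componentExtend ha g := rfl

theorem componentExtend_mul {a : AnnQuotient B M} (ha : IsAtom a)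
    (f g : Module.End BoolSemifield (componentAt a)) :
    componentExtend ha (f * g) = componentExtend ha f * componentExtend ha g := by
  ext m
  rw [Module.End.mul_apply, componentExtend_apply, componentExtend_apply, Module.End.mul_apply]
  refine congrArg (fun x : componentAt a => (f x : M)) (Subtype.ext ?_)
  exact (smul_of_mem_componentAt (Subtype.mem _)).symm

theorem componentExtend_mul_restrict {a : AnnQuotient B M} (ha : IsAtom a)
    (g : Module.End BoolSemifield (componentAt a)) (f : Module.End (BoolSemiring B) M) :
    componentExtend ha (g * componentRestrict a f) = componentExtend ha g * f := by
  ext m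
  rw [Module.End.mul_apply, componentExtend_apply, componentExtend_apply, Module.End.mul_apply]
  exact congrArg (fun x : componentAt a => (g x : M)) (Subtype.ext (map_annQuotient_smul f a m))

theorem componentExtend_restrict {a : AnnQuotient B M} (ha : IsAtom a)
    (f : Module.End (BoolSemiring B) M) :
    componentExtend ha (componentRestrict a f) = f * annSMulEnd a := rfl

theorem componentRestrict_surjective {a : AnnQuotient B M} (ha : IsAtom a) :
    Function.Surjective (componentRestrict a) := fun g =>
  ⟨componentExtend ha g, LinearMap.ext fun x => Subtype.ext
    (congrArg (fun y : componentAt a => (g y : M)) (Subtype.ext (smul_of_mem_componentAt x.2)))⟩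

theorem sum_atoms_annQuotient [Finite (AnnQuotient B M)]
    [Fintype {a : AnnQuotient B M // IsAtom a}] :
    ∑ a : {a : AnnQuotient B M // IsAtom a}, (a : AnnQuotient B M) = 1 := by
  classical
  set s := ∑ a : {a : AnnQuotient B M // IsAtom a}, (a : AnnQuotient B M) with hs
  rcases eq_bot_or_exists_atom_le sᶜ with h | ⟨a, ha, has⟩
  · exact compl_eq_bot.1 h
  · exfalso
    have h1 : a ≤ s := by
      rw [hs, ← Finset.add_sum_erase _ _ (Finset.mem_univ (⟨a, ha⟩ : {a // IsAtom a}))]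
      exact le_sup_left
    exact ha.1 (le_bot_iff.1 ((le_inf h1 has).trans inf_compl_eq_bot.le))

theorem isRightCPSemiring_of_components [Finite (AnnQuotient B M)]
    (h : ∀ a : AnnQuotient B M, IsAtom a →
      IsRightCPSemiring (Module.End BoolSemifield (componentAt a))) :
    IsRightCPSemiring (Module.End (BoolSemiring B) M) := by
  simp only [isRightCPSemiring_iff] at h
  rw [isRightCPSemiring_iff]
  intro c
  have := Fintype.ofFinite {a : AnnQuotient B M // IsAtom a}
  have key : ∀ a : {a : AnnQuotient B M // IsAtom a},
      ∃ e : Module.End BoolSemifield (componentAt (a : AnnQuotient B M)),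
        c.r (componentExtend a.2 e) (annSMulEnd (a : AnnQuotient B M)) ∧
        ∀ f g, c.r f g → componentExtend a.2 e * f = componentExtend a.2 e * g := by
    rintro ⟨a, ha⟩
    obtain ⟨e, he, hk⟩ := h a ha (rightCon
      (fun f g => c.r (componentExtend ha f) (componentExtend ha g))
      ⟨fun _ => c.iseqv.refl _, fun h => c.iseqv.symm h, fun h h' => c.iseqv.trans h h'⟩
      (fun h h' => by rw [componentExtend_add, componentExtend_add]; exact c.add' h h')
      (fun s f g h => by
        rw [componentExtend_mul, componentExtend_mul]
        exact c.smul (MulOpposite.op (componentExtend ha s)) h))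
    -- Extension by zero carries the identity of `M a` to the action of `a`, so `he` already has the
    -- required form.
    refine ⟨e, he, fun f g hfg => ?_⟩
    rw [← componentExtend_mul_restrict, ← componentExtend_mul_restrict]
    congr 1
    apply hk
    change c.r (componentExtend ha (componentRestrict a f))
      (componentExtend ha (componentRestrict a g))
    rw [componentExtend_restrict, componentExtend_restrict]
    exact c.smul (MulOpposite.op (annSMulEnd a)) hfg
  choose e he hk using key
  refine ⟨∑ a, componentExtend a.2 (e a), ?_, fun f g hfg => ?_⟩
  -- The identity is the sum of the actions of the atoms, and each summand is congruent to the
  -- extension of `e a`.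
  · have h1 : (1 : Module.End (BoolSemiring B) M) =
        ∑ a : {a : AnnQuotient B M // IsAtom a}, annSMulEnd (a : AnnQuotient B M) := by
      ext m
      simp only [LinearMap.sum_apply, annSMulEnd_apply]
      rw [← Finset.sum_smul, sum_atoms_annQuotient, one_smul, Module.End.one_apply]
    rw [h1, ← c.mkLinear_eq_iff, map_sum, map_sum]
    exact Finset.sum_congr rfl fun a _ => c.mkLinear_eq_iff.2 (he a)
  · rw [Finset.sum_mul, Finset.sum_mul]
    exact Finset.sum_congr rfl fun a _ => hk a f g hfg

end Semimodule

theorem theorem5p10 {B : Type u} [BooleanAlgebra B] {M : Type v} [AddCommMonoid M]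
    [Module (BoolSemiring B) M] [Nontrivial M] :
    (IsRightCPSemiring (Module.End (BoolSemiring B) M) ↔
      Finite (AnnQuotient B M) ∧ ∀ a : AnnQuotient B M, IsAtom a →
        Finite (componentAt a) ∧ IsDistributiveLattice (componentAt a) ∧
          IsRightCPSemiring (Module.End BoolSemifield (componentAt a))) ∧
    (IsRightCPSemiring (Module.End (BoolSemiring B) M) ↔
      Finite (AnnQuotient B M) ∧ ∀ a : AnnQuotient B M, IsAtom a →
        Finite (componentAt a) ∧ IsDistributiveLattice (componentAt a) ∧
          AllQuotientsDistributive (componentAt a)) ∧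
    (IsRightCPSemiring (Module.End (BoolSemiring B) M) ↔
      Finite (AnnQuotient B M) ∧ ∀ a : AnnQuotient B M, IsAtom a →
        Finite (componentAt a) ∧ IsDistributiveLattice (componentAt a) ∧
          HasSmallSteps (componentAt a)) := by
  have hcomp : ∀ h : IsRightCPSemiring (Module.End (BoolSemiring B) M),
      ∀ a : AnnQuotient B M, IsAtom a →
        IsRightCPSemiring (Module.End BoolSemifield (componentAt a)) ∧
          Finite (componentAt a) ∧ HasSmallJoins (componentAt a) := by
    intro h a ha
    have h1 := h.of_surjective (componentRestrict a) (componentRestrict_surjective ha)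
    exact ⟨h1, finite_of_isRightCPSemiring h1, hasSmallJoins_of_isRightCPSemiring h1⟩
  refine ⟨⟨fun h => ⟨finite_annQuotient_of_isRightCPSemiring h, fun a ha => ?_⟩, fun h => ?_⟩,
    ⟨fun h => ⟨finite_annQuotient_of_isRightCPSemiring h, fun a ha => ?_⟩, fun h => ?_⟩,
    ⟨fun h => ⟨finite_annQuotient_of_isRightCPSemiring h, fun a ha => ?_⟩, fun h => ?_⟩⟩
  · obtain ⟨h1, h2, h3⟩ := hcomp h a ha
    exact ⟨h2, h3.isDistributiveLattice, h1⟩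
  · obtain ⟨_, h⟩ := h
    exact isRightCPSemiring_of_components fun a ha => (h a ha).2.2
  · obtain ⟨h1, h2, h3⟩ := hcomp h a ha
    exact ⟨h2, h3.isDistributiveLattice, h3.allQuotientsDistributive⟩
  · obtain ⟨_, h⟩ := h
    refine isRightCPSemiring_of_components fun a ha => ?_
    obtain ⟨_, h2, h3⟩ := h a ha
    exact isRightCPSemiring_of_allQuotientsDistributive h2 h3
  · obtain ⟨h1, h2, h3⟩ := hcomp h a ha
    exact ⟨h2, h3.isDistributiveLattice, h3.hasSmallSteps⟩
  · obtain ⟨_, h⟩ := h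
    refine isRightCPSemiring_of_components fun a ha => ?_
    obtain ⟨_, h2, h3⟩ := h a ha
    exact isRightCPSemiring_of_allQuotientsDistributive h2 h3.hasSmallJoins.allQuotientsDistributive
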